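/- A \emph{partial finite automaton} (PFA) $M=(Q,\Sigma,\cdot)$ consists of a finite set $Q$ of states, a finite alphabet $\Sigma$, and a map $\cdot : Q\times\Sigma\to Q\cup\{\bot\}$, where $qa=\bot$ means that $qa$ is undefined. For $S\subseteq Q$ and $a\in\Sigma$ put $Sa=\{sa \mid s\in S\}$ if $sa\neq\bot$ for all $s\in S$, and $Sa=\varnothing$ otherwise. Extend both actions to words letter by letter, from left to right, where $\bot a=\bot$. The PFA $M$ is \emph{transitive} if for all $q,q'\in Q$ there is a word $w\in\Sigma^*$ with $qw=q'$. A word $w$ \emph{carefully synchronizes} a subset $S\subseteq Q$ if $|Sw|=1$, and $S$ is \emph{carefully synchronizable} if such a word exists. Theorem. For every $n\ge 1$ there exist a transitive PFA $M_n$ with exactly $n$ states and exactly $2$ symbols, and a carefully synchronizable subset $S_n$ of its states, such that the length $L_n$ of a shortest word that carefully synchronizes $S_n$ satisfies $$L_n=\Omega\big((3-\epsilon)^{n/3}\big)\quad\text{for every } 0<\epsilon<3,\qquad\text{and in particular}\qquad L_n=\Omega(1.4422^n).$$ Here $L_n=\Omega(g(n))$ means that there are a constant $c>0$ (which may depend on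 $\epsilon$) and an $n_0$ such that $L_n\ge c\,g(n)$ for all $n\ge n_0$. -/

import Mathlib

open Filter

/-- A partial finite automaton with states `Q` and alphabet `A`: the transition function takes
values in `Q ∪ {⊥}`, where `⊥` (undefined) is `none`. -/
structure PFA (Q A : Type*) where
  /-- The partial transition function. -/
  step : Q → A → Option Q

namespace PFA

variable {Q A : Type*} (M : PFA Q A)

/-- The state `q w`, or `none` if it is undefined; `q λ = q` and `q (x w) = (q x) w`. -/
def eval (q : Q) : List A → Option Q
  | [] => some q
  | x :: w => (M.step q x).bind fun q' => eval q' w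

/-- `S a` is `{s a | s ∈ S}` if `s a` is defined for all `s ∈ S`, and it is empty otherwise. -/
def stepSet (S : Set Q) (a : A) : Set Q :=
  {q | (∀ s ∈ S, M.step s a ≠ none) ∧ ∃ s ∈ S, M.step s a = some q}

/-- The set of states `S w`; `S λ = S` and `S (x w) = (S x) w`. -/
def evalSet (S : Set Q) : List A → Set Q
  | [] => S
  | x :: w => evalSet (M.stepSet S x) w

/-- Every state can be reached from every state. -/
def IsTransitive : Prop :=
  ∀ q q' : Q, ∃ w : List A, M.eval q w = some q'

/-- The word `w` carefully synchronizes the subset `S`. -/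
def CarefullySynchronizes (S : Set Q) (w : List A) : Prop :=
  (M.evalSet S w).ncard = 1

/-- The subset `S` is carefully synchronizable, and its shortest carefully synchronizing words
have length `l`. -/
def IsShortestSyncLength (S : Set Q) (l : ℕ) : Prop :=
  IsLeast {m : ℕ | ∃ w : List A, w.length = m ∧ M.CarefullySynchronizes S w} l

end PFA

/-! The start set encodes a ternary counter with k = p(p+1) digits, all zero. The digits rotate on a
ring, which costs 3k states. Control is exercised by two cycles of coprime lengths p and p+1, which
cost only O(p) states and stand at 0 simultaneously exactly once per round of k rotations. A word
splits into blocks 0^i 1; each block rotates the ring by one and applies operation i to the digit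
under the head: keep, reset 2 to 0 with a carry, increment, or synchronize. A forbidden operation is
undefined on some active state, which kills the word. Reset and increment need a pending carry or
the start of a round; synchronization needs a carry pending at the start of a round, that is, an
overflow.

Hence the counter gains at most one per round (`ValueBound`, maintained in `exists_config`), and
overflow takes at least 3^k - 1 letters (`pow_le_length_of_carefullySynchronizes`). Conversely,
incrementing in every round leads to overflow, after which (0001)^k sends everything to `sink 0`
(`exists_carefullySynchronizes`). The state `sink 0` is also a hub for transitivity.

The total is 3k + O(√k) states plus padding, so every large n is realized with k ≥ n/3 - O(√n), and
the loss in the exponent is absorbed by replacing 3 with any smaller base. -/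

namespace PFA

/-! ### Careful synchronization, reachability and renaming of states -/

section General

variable {Q A : Type*} (M : PFA Q A)

theorem eval_append (q : Q) (u w : List A) :
    M.eval q (u ++ w) = (M.eval q u).bind fun q' => M.eval q' w := by
  induction u generalizing q with
  | nil => rfl
  | cons x u ih =>
    simp only [List.cons_append, eval, Option.bind_assoc]
    exact congrArg _ (funext ih)

theorem eval_append_of_eq {q q' : Q} {u : List A} (h : M.eval q u = some q') (w : List A) :
    M.eval q (u ++ w) = M.eval q' w := by
  rw [eval_append, h]; rfl

theorem eval_cons_of_eq {q q' : Q} {x : A} (h : M.step q x = some q') (w : List A) :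
    M.eval q (x :: w) = M.eval q' w := by
  simp [eval, h]

theorem eval_concat (q : Q) (w : List A) (x : A) :
    M.eval q (w ++ [x]) = (M.eval q w).bind fun q' => M.step q' x := by
  rw [eval_append]
  congr 1
  funext q'
  simp [eval]

theorem evalSet_empty (w : List A) : M.evalSet ∅ w = ∅ := by
  induction w with
  | nil => rfl
  | cons x w ih =>
    have : M.stepSet ∅ x = ∅ := by ext; simp [stepSet]
    rw [evalSet, this, ih]

/-- One undefined transition empties the set, and the empty set never recovers, so ending with one
state forces every path to be defined. Nonemptiness excludes the vacuous case on the right. -/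
theorem carefullySynchronizes_iff {S : Set Q} (hS : S.Nonempty) (w : List A) :
    M.CarefullySynchronizes S w ↔ ∃ q, ∀ s ∈ S, M.eval s w = some q := by
  unfold CarefullySynchronizes
  induction w generalizing S with
  | nil =>
    rw [evalSet, Set.ncard_eq_one]
    constructor
    · rintro ⟨q, rfl⟩
      exact ⟨q, by simp [eval]⟩
    · rintro ⟨q, h⟩
      refine ⟨q, hS.subset_singleton_iff.mp fun s hs => ?_⟩
      simpa [eval] using h s hs
  | cons x w ih =>
    rw [evalSet]
    by_cases hd : ∀ s ∈ S, M.step s x ≠ none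
    · have hne : (M.stepSet S x).Nonempty := by
        obtain ⟨s, hs⟩ := hS
        obtain ⟨q, hq⟩ := Option.ne_none_iff_exists'.mp (hd s hs)
        exact ⟨q, hd, s, hs, hq⟩
      rw [ih hne]
      refine exists_congr fun q => ⟨fun h s hs => ?_, fun h t ht => ?_⟩
      · obtain ⟨t, ht⟩ := Option.ne_none_iff_exists'.mp (hd s hs)
        rw [M.eval_cons_of_eq ht]
        exact h t ⟨hd, s, hs, ht⟩
      · obtain ⟨-, s, hs, hst⟩ := ht
        rw [← M.eval_cons_of_eq hst]
        exact h s hs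
    · have hempty : M.stepSet S x = ∅ := by
        ext q; simp only [stepSet, Set.mem_ofPred_eq, Set.mem_empty_iff_false, iff_false]
        exact fun h => hd h.1
      push Not at hd
      obtain ⟨s, hs, hsx⟩ := hd
      rw [hempty, evalSet_empty]
      simp only [Set.ncard_empty, zero_ne_one, false_iff]
      rintro ⟨q, h⟩
      simpa [eval, hsx] using h s hs

/-- `q'` can be reached from `q`. -/
def Reaches (q q' : Q) : Prop := ∃ w : List A, M.eval q w = some q'

variable {M}

theorem Reaches.refl (q : Q) : M.Reaches q q := ⟨[], rfl⟩

theorem Reaches.trans {q q' q'' : Q} (h : M.Reaches q q') (h' : M.Reaches q' q'') :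
    M.Reaches q q'' := by
  obtain ⟨u, hu⟩ := h
  obtain ⟨w, hw⟩ := h'
  exact ⟨u ++ w, by rw [M.eval_append_of_eq hu, hw]⟩

theorem Reaches.of_step {q q' : Q} (x : A) (h : M.step q x = some q') : M.Reaches q q' :=
  ⟨[x], by simp [eval, h]⟩

theorem Reaches.of_forall_succ {f : ℕ → Q} (h : ∀ t, M.Reaches (f t) (f (t + 1))) (t : ℕ) :
    M.Reaches (f 0) (f t) := by
  induction t with
  | zero => exact .refl _
  | succ t ih => exact ih.trans (h t)

theorem isTransitive_of_hub (z : Q) (h₁ : ∀ q, M.Reaches q z) (h₂ : ∀ q, M.Reaches z q) :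
    M.IsTransitive := fun q q' => (h₁ q).trans (h₂ q')

/-- The automaton obtained by renaming the states. -/
def rename {Q' : Type*} (M : PFA Q A) (e : Q ≃ Q') : PFA Q' A where
  step q x := (M.step (e.symm q) x).map e

theorem eval_rename {Q' : Type*} (M : PFA Q A) (e : Q ≃ Q') (q : Q) (w : List A) :
    (M.rename e).eval (e q) w = (M.eval q w).map e := by
  induction w generalizing q with
  | nil => rfl
  | cons x w ih =>
    cases h : M.step q x <;> simp [eval, rename, h]
    exact ih _

theorem IsTransitive.rename {Q' : Type*} (h : M.IsTransitive) (e : Q ≃ Q') :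
    (M.rename e).IsTransitive := by
  intro q q'
  obtain ⟨w, hw⟩ := h (e.symm q) (e.symm q')
  refine ⟨w, ?_⟩
  have := M.eval_rename e (e.symm q) w
  rw [hw] at this
  simpa using this

theorem carefullySynchronizes_rename {Q' : Type*} (M : PFA Q A) (e : Q ≃ Q') {S : Set Q}
    (hS : S.Nonempty) (w : List A) :
    (M.rename e).CarefullySynchronizes (e '' S) w ↔ M.CarefullySynchronizes S w := by
  rw [carefullySynchronizes_iff _ (hS.image e), carefullySynchronizes_iff _ hS]
  rw [← e.exists_congr_right]
  simp only [Set.forall_mem_image, eval_rename]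
  refine exists_congr fun q => forall₂_congr fun s _ => ?_
  rw [← Option.map_some, (Option.map_injective e.injective).eq_iff]

theorem exists_isShortestSyncLength {S : Set Q} (h : ∃ w, M.CarefullySynchronizes S w) :
    ∃ l, M.IsShortestSyncLength S l := by
  obtain ⟨w, hw⟩ := h
  have hne : {m : ℕ | ∃ w : List A, w.length = m ∧ M.CarefullySynchronizes S w}.Nonempty :=
    ⟨_, w, rfl, hw⟩
  exact ⟨sInf _, Nat.sInf_mem hne, fun m hm => Nat.sInf_le hm⟩

end General

end PFA

/-! ### The counter automaton -/

/-- The states of the counter automaton: two control cycles, a ring of ternary digits whose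
position `0` is the head, further head states that count the letters `0` read by the head, a
synchronized state with the same kind of counting, and a cycle for padding. -/
inductive CounterState (N : Bool → ℕ) (k r : ℕ) : Type
  | ctl (c : Bool) (j : ZMod (N c)) (carry : Bool) (i : Fin 4)
  | ring (j : ZMod k) (v : Fin 3)
  | head (v : Fin 3) (i : Fin 3)
  | sink (i : Fin 4)
  | pad (j : ZMod r)

namespace CounterState

variable {N : Bool → ℕ} {k r : ℕ}

/-- The states as a sum type. -/
def equivSum : CounterState N k r ≃
    (Σ c, ZMod (N c) × Bool × Fin 4) ⊕ (ZMod k × Fin 3) ⊕ (Fin 3 × Fin 3) ⊕ Fin 4 ⊕ ZMod r where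
  toFun
    | ctl c j m i => .inl ⟨c, j, m, i⟩
    | ring j v => .inr (.inl (j, v))
    | head v i => .inr (.inr (.inl (v, i)))
    | sink i => .inr (.inr (.inr (.inl i)))
    | pad j => .inr (.inr (.inr (.inr j)))
  invFun
    | .inl ⟨c, j, m, i⟩ => ctl c j m i
    | .inr (.inl (j, v)) => ring j v
    | .inr (.inr (.inl (v, i))) => head v i
    | .inr (.inr (.inr (.inl i))) => sink i
    | .inr (.inr (.inr (.inr j))) => pad j
  left_inv := by rintro (_ | _ | _ | _ | _) <;> rfl
  right_inv := by rintro (_ | _ | _ | _ | _) <;> rfl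

theorem nonempty_equiv_fin [∀ c, NeZero (N c)] [NeZero k] [NeZero r] {n : ℕ}
    (hn : n = 8 * (N true + N false) + 3 * k + 13 + r) :
    Nonempty (CounterState N k r ≃ Fin n) := by
  refine ⟨equivSum.trans (Fintype.equivFinOfCardEq ?_)⟩
  simp [ZMod.card]
  omega

/-- The state of a digit `v` at distance `j` behind the head, after the head has read `i` letters
`0` modulo `4`. -/
def digit (j : ZMod k) (v : Fin 3) (i : Fin 4) : CounterState N k r :=
  if j = 0 then
    match i with
    | 0 => ring 0 v
    | 1 => head v 0
    | 2 => head v 1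
    | 3 => head v 2
  else ring j v

/-- The transition of a control cycle for the letter `1` after `i` letters `0`. -/
def ctlStep (c : Bool) (j : ZMod (N c)) (m : Bool) : Fin 4 → Option (CounterState N k r)
  | 0 => some (ctl c (j + 1) false 0)
  | 1 => if m = true ∨ j = 0 then some (ctl c (j + 1) true 0) else none
  | 2 => if m = true ∨ j = 0 then some (ctl c (j + 1) false 0) else none
  | 3 => if m = true ∧ j = 0 then some (sink 0) else none

/-- The transition of the digit under the head for the letter `1` after `i` letters `0`. -/
def headStep (v : Fin 3) : Fin 4 → Option (CounterState N k r)
  | 0 => some (ring 1 v)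
  | 1 => if v = 2 then some (ring 1 0) else none
  | 2 => if v = 2 then none else some (ring 1 (v + 1))
  | 3 => some (sink 0)

end CounterState

open CounterState

/-- The counter automaton. After `i` letters `0` (modulo `4`), the letter `1` moves all digits by
one position, where the digit under the head is kept for `i = 0`, reset from `2` to `0` for
`i = 1`, incremented for `i = 2`, and synchronized for `i = 3`. -/
def counterPFA (N : Bool → ℕ) (k r : ℕ) : PFA (CounterState N k r) (Fin 2) where
  step
    | ctl c j m i, 0 => some (ctl c j m (i + 1))
    | ctl c j m i, 1 => ctlStep c j m i
    | ring j v, 0 => if j = 0 then some (head v 0) else some (ring j v)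
    | ring j v, 1 => some (ring (j + 1) v)
    | head v i, 0 => some <| match i with
      | 0 => head v 1
      | 1 => head v 2
      | 2 => ring 0 v
    | head v i, 1 => headStep v i.succ
    | sink i, 0 => some (sink (i + 1))
    | sink 0, 1 => some (ctl true 0 false 0)
    | sink 1, 1 => some (ctl false 0 false 0)
    | sink 2, 1 => some (pad 0)
    | sink 3, 1 => some (sink 0)
    | pad _, 0 => some (ring 0 0)
    | pad j, 1 => some (pad (j + 1))

/-! ### Action of blocks on control states and digits -/

namespace CounterState

variable {N : Bool → ℕ} {k r : ℕ}

local notation "M" => counterPFA N k r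

theorem digit_zero_count (j : ZMod k) (v : Fin 3) :
    (digit j v 0 : CounterState N k r) = ring j v := by
  unfold digit
  split_ifs with h <;> simp [h]

theorem step_digit_zero (j : ZMod k) (v : Fin 3) (i : Fin 4) :
    (M).step (digit j v i) 0 = some (digit j v (i + 1)) := by
  by_cases h : j = 0
  · subst h
    fin_cases i <;> simp [digit, counterPFA]
  · simp [digit, h, counterPFA]

theorem step_digit_one_of_ne {j : ZMod k} (hj : j ≠ 0) (v : Fin 3) (i : Fin 4) :
    (M).step (digit j v i) 1 = some (digit (j + 1) v 0) := by
  simp [digit_zero_count]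
  simp [digit, hj, counterPFA]

theorem step_digit_one_head (v : Fin 3) (i : Fin 4) :
    (M).step (digit 0 v i) 1 = headStep v i := by
  fin_cases i <;> simp [digit, counterPFA, headStep]

theorem step_ctl_zero (c : Bool) (j : ZMod (N c)) (m : Bool) (i : Fin 4) :
    (M).step (ctl c j m i) 0 = some (ctl c j m (i + 1)) := rfl

theorem step_ctl_one (c : Bool) (j : ZMod (N c)) (m : Bool) (i : Fin 4) :
    (M).step (ctl c j m i) 1 = ctlStep c j m i := rfl

/-- The word that consists of `i` letters `0` and a letter `1`. -/
def block (i : Fin 4) : List (Fin 2) := List.replicate i 0 ++ [1]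

theorem eval_ctl_block (c : Bool) (j : ZMod (N c)) (m : Bool) (i : Fin 4) :
    (M).eval (ctl c j m 0) (block i) = ctlStep c j m i := by
  fin_cases i <;> simp [block, PFA.eval, step_ctl_zero, step_ctl_one, List.replicate]

theorem eval_digit_block_of_ne {j : ZMod k} (hj : j ≠ 0) (v : Fin 3) (i : Fin 4) :
    (M).eval (digit j v 0) (block i) = some (digit (j + 1) v 0) := by
  fin_cases i <;>
    simp [block, PFA.eval, step_digit_zero, step_digit_one_of_ne hj, List.replicate]

theorem eval_digit_block_head (v : Fin 3) (i : Fin 4) :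
    (M).eval (digit 0 v 0) (block i) = headStep v i := by
  fin_cases i <;>
    simp [block, PFA.eval, step_digit_zero, step_digit_one_head, List.replicate]

theorem eval_sink_block : (M).eval (sink 0) (block 3) = some (sink 0) := rfl

/-- The words `(0001)^s`. -/
def syncWord : ℕ → List (Fin 2)
  | 0 => []
  | s + 1 => block 3 ++ syncWord s

theorem eval_sink_syncWord (s : ℕ) : (M).eval (sink 0) (syncWord s) = some (sink 0) := by
  induction s with
  | zero => rfl
  | succ s ih => rw [syncWord, PFA.eval_append_of_eq _ eval_sink_block, ih]

/-- A digit s positions before the head arrives there within s blocks, and the next block 0001 sends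
it to the sink, which is fixed by the remaining blocks. -/
theorem eval_digit_syncWord (s : ℕ) (v : Fin 3) :
    (M).eval (digit (-(s : ZMod k)) v 0) (syncWord (s + 1)) = some (sink 0) := by
  induction s with
  | zero =>
    rw [syncWord, Nat.cast_zero, neg_zero, PFA.eval_append_of_eq _ (q' := sink 0)]
    · exact eval_sink_syncWord _
    · rw [eval_digit_block_head]; rfl
  | succ s ih =>
    rw [syncWord]
    -- When k divides s + 1 the digit is already under the head.
    by_cases h : -((s + 1 : ℕ) : ZMod k) = 0
    · rw [h, PFA.eval_append_of_eq _ (q' := sink 0)]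
      · exact eval_sink_syncWord _
      · rw [eval_digit_block_head]; rfl
    · rw [PFA.eval_append_of_eq _ (eval_digit_block_of_ne h v 3)]
      convert ih using 3
      push_cast; ring

theorem eval_digit_syncWord' [NeZero k] (j : ZMod k) (v : Fin 3) :
    (M).eval (digit j v 0) (syncWord k) = some (sink 0) := by
  have h := eval_digit_syncWord (N := N) (k := k) (r := r) (-j).val v
  rw [ZMod.natCast_zmod_val, neg_neg] at h
  have hlt := ZMod.val_lt (-j)
  have hsplit : ∀ a b : ℕ, syncWord (a + b) = syncWord a ++ syncWord b := by
    intro a b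
    induction a with
    | zero => simp [syncWord]
    | succ a ih => rw [Nat.succ_add, syncWord, ih, syncWord, List.append_assoc]
  obtain ⟨b, hb⟩ := Nat.exists_eq_add_of_le (Nat.succ_le_of_lt hlt)
  rw [show syncWord k = syncWord ((-j).val + 1) ++ syncWord b by rw [← hsplit]; exact congrArg _ hb,
    PFA.eval_append_of_eq _ h, eval_sink_syncWord]

theorem eval_ctl_syncWord [NeZero k] {c : Bool} {j : ZMod (N c)} (hj : j = 0) :
    (M).eval (ctl c j true 0) (syncWord k) = some (sink 0) := by
  obtain ⟨s, hs⟩ := Nat.exists_eq_succ_of_ne_zero (NeZero.ne k)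
  have h : (M).eval (ctl c j true 0) (block 3) = some (sink 0) := by
    rw [eval_ctl_block]; simp [ctlStep, hj]
  rw [show syncWord k = block 3 ++ syncWord s by rw [hs]; rfl,
    PFA.eval_append_of_eq _ h, eval_sink_syncWord]

/-! ### Transitivity -/

section Transitivity

open PFA

theorem reaches_cycle {n : ℕ} [NeZero n] {f : ZMod n → CounterState N k r}
    (h : ∀ j, (M).Reaches (f j) (f (j + 1))) (j j' : ZMod n) : (M).Reaches (f j) (f j') := by
  have hsucc (t : ℕ) : (M).Reaches (f (j + t)) (f (j + (t + 1 : ℕ))) := by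
    simpa [add_assoc] using h (j + t)
  simpa using Reaches.of_forall_succ hsucc (j' - j).val

theorem reaches_ctl_count [∀ c, NeZero (N c)] (c : Bool) (j : ZMod (N c)) (m : Bool)
    (i i' : Fin 4) : (M).Reaches (ctl c j m i) (ctl c j m i') :=
  reaches_cycle (n := 4) (f := fun i : Fin 4 => ctl c j m i)
    (fun _ => .of_step 0 rfl) i i'

theorem reaches_sink_count (i i' : Fin 4) : (M).Reaches (sink i) (sink i') :=
  reaches_cycle (n := 4) (f := fun i : Fin 4 => sink i) (fun _ => .of_step 0 rfl) i i'

theorem reaches_digit_count (j : ZMod k) (v : Fin 3) (i i' : Fin 4) :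
    (M).Reaches (digit j v i) (digit j v i') :=
  reaches_cycle (n := 4) (f := fun i : Fin 4 => digit j v i)
    (fun _ => .of_step 0 (step_digit_zero _ _ _)) i i'

theorem reaches_ctl_false [∀ c, NeZero (N c)] (c : Bool) (j : ZMod (N c)) (m : Bool)
    (j' : ZMod (N c)) : (M).Reaches (ctl c j m 0) (ctl c j' false 0) :=
  Reaches.trans (.of_step 1 rfl)
    (reaches_cycle (f := fun j => ctl c j false 0) (fun _ => .of_step 1 rfl) (j + 1) j')

/-- A carry can only be created at position 0; from there block 01 preserves it along the whole
cycle. -/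
theorem reaches_ctl_true [∀ c, NeZero (N c)] (c : Bool) (j j' : ZMod (N c)) :
    (M).Reaches (ctl c j false 0) (ctl c j' true 0) := by
  have h₁ : (M).Reaches (ctl c 0 false 0) (ctl c 1 true 0) :=
    ⟨block 1, by rw [eval_ctl_block]; simp [ctlStep]⟩
  have h₂ (j : ZMod (N c)) : (M).Reaches (ctl c j true 0) (ctl c (j + 1) true 0) :=
    ⟨block 1, by rw [eval_ctl_block]; simp [ctlStep]⟩
  exact ((reaches_ctl_false c j false 0).trans h₁).trans
    (reaches_cycle (f := fun j => ctl c j true 0) h₂ 1 j')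

theorem reaches_sink [∀ c, NeZero (N c)] [NeZero k] (q : CounterState N k r) :
    (M).Reaches q (sink 0) := by
  have hring (j : ZMod k) (v : Fin 3) : (M).Reaches (ring j v) (sink 0) :=
    ⟨syncWord k, by rw [← digit_zero_count]; exact eval_digit_syncWord' j v⟩
  cases q with
  | ctl c j m i =>
    refine (reaches_ctl_count c j m i 0).trans <| (reaches_ctl_false c j m 0).trans <|
      (reaches_ctl_true c 0 0).trans ⟨syncWord k, eval_ctl_syncWord rfl⟩
  | ring j v => exact hring j v
  | head v i =>
    refine Reaches.trans ?_ (hring 0 v)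
    have := reaches_digit_count (N := N) (r := r) (0 : ZMod k) v i.succ 0
    fin_cases i <;> simpa [digit] using this
  | sink i => exact reaches_sink_count i 0
  | pad j => exact Reaches.trans (.of_step 0 rfl) (hring 0 0)

/-- The zero count in the sink selects the exit: either control cycle or the padding. The padding
leads to a digit 0, from which increments and rotations give all other digits. -/
theorem reaches_from_sink [∀ c, NeZero (N c)] [NeZero k] [NeZero r] (q : CounterState N k r) :
    (M).Reaches (sink 0) q := by
  have hctl (c : Bool) : (M).Reaches (sink 0) (ctl c 0 false 0) := by
    cases c
    · exact (reaches_sink_count 0 1).trans (.of_step 1 rfl)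
    · exact .of_step 1 rfl
  have hpad (j : ZMod r) : (M).Reaches (sink 0) (pad j) :=
    ((reaches_sink_count 0 2).trans (.of_step 1 rfl)).trans
      (reaches_cycle (f := pad) (fun _ => .of_step 1 rfl) 0 j)
  have hshift (v : Fin 3) (j j' : ZMod k) : (M).Reaches (ring j v) (ring j' v) :=
    reaches_cycle (f := fun j => ring j v) (fun _ => .of_step 1 rfl) j j'
  have hincr (v : Fin 3) (hv : v ≠ 2) : (M).Reaches (ring 0 v) (ring 0 (v + 1)) := by
    refine Reaches.trans ⟨block 2, ?_⟩ (hshift (v + 1) 1 0)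
    rw [← digit_zero_count, eval_digit_block_head]
    simp [headStep, hv]
  have h0 : (M).Reaches (sink 0) (ring 0 0) := (hpad 0).trans (.of_step 0 rfl)
  have hring (v : Fin 3) : (M).Reaches (sink 0) (ring 0 v) := by
    have h1 := h0.trans (hincr 0 (by decide))
    have h2 := h1.trans (hincr 1 (by decide))
    fin_cases v
    exacts [h0, h1, h2]
  cases q with
  | ctl c j m i =>
    refine Reaches.trans ?_ (reaches_ctl_count c j m 0 i)
    cases m
    · exact (hctl c).trans (reaches_ctl_false c 0 false j)
    · exact (hctl c).trans (reaches_ctl_true c 0 j)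
  | ring j v => exact (hring v).trans (hshift v 0 j)
  | head v i =>
    refine (hring v).trans ?_
    have := reaches_digit_count (N := N) (r := r) (0 : ZMod k) v 0 i.succ
    fin_cases i <;> simpa [digit] using this
  | sink i => exact reaches_sink_count 0 i
  | pad j => exact hpad j

theorem isTransitive_counterPFA [∀ c, NeZero (N c)] [NeZero k] [NeZero r] : (M).IsTransitive :=
  isTransitive_of_hub (sink 0) reaches_sink reaches_from_sink

end Transitivity

/-- The number with the ternary digits `x`. -/
def value [NeZero k] (x : ZMod k → Fin 3) : ℕ := ∑ d, (x d : ℕ) * 3 ^ d.val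

theorem value_update [NeZero k] (x : ZMod k → Fin 3) (d : ZMod k) (v : Fin 3) :
    value (Function.update x d v) + (x d : ℕ) * 3 ^ d.val = value x + (v : ℕ) * 3 ^ d.val := by
  unfold value
  rw [← Finset.add_sum_erase _ _ (Finset.mem_univ d),
    ← Finset.add_sum_erase (a := d) _ (fun d => (x d : ℕ) * 3 ^ d.val) (Finset.mem_univ d)]
  have : ∑ e ∈ Finset.univ.erase d, (Function.update x d v e : ℕ) * 3 ^ e.val =
      ∑ e ∈ Finset.univ.erase d, (x e : ℕ) * 3 ^ e.val :=
    Finset.sum_congr rfl fun e he => by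
      rw [Function.update_of_ne (Finset.ne_of_mem_erase he)]
  rw [this, Function.update_self]
  ring

theorem value_reset [NeZero k] {x : ZMod k → Fin 3} {d : ZMod k} (h : x d = 2) :
    value (Function.update x d 0) + 2 * 3 ^ d.val = value x := by
  simpa [h] using value_update x d 0

theorem value_increment [NeZero k] {x : ZMod k → Fin 3} {d : ZMod k} (h : x d ≠ 2) :
    value (Function.update x d (x d + 1)) = value x + 3 ^ d.val := by
  have := value_update x d (x d + 1)
  have hv : ((x d + 1 : Fin 3) : ℕ) = x d + 1 := by
    generalize x d = v at h
    revert v; decide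
  rw [hv] at this
  linarith

/-- The set of states from which the counter starts. -/
def startSet : Set (CounterState N k r) :=
  {q | (∃ c, q = ctl c 0 false 0) ∨ ∃ j, q = digit j 0 0}

theorem startSet_nonempty : (startSet : Set (CounterState N k r)).Nonempty :=
  ⟨_, .inl ⟨true, rfl⟩⟩

/-! ### Lower bound: the counter must run through its whole range -/

section LowerBound

/-- The bound on the value `V` of the counter after `t` moves of the digits. -/
def ValueBound (k t : ℕ) (m : Bool) (V : ℕ) : Prop :=
  V ≤ t / k + 1 ∧ (k ∣ t → m = false ∧ V ≤ t / k) ∧ (m = true → V + 3 ^ (t % k) ≤ t / k + 1)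

theorem succ_div_mod_of_not_dvd {k t : ℕ} (h : ¬ k ∣ t + 1) :
    (t + 1) / k = t / k ∧ (t + 1) % k = t % k + 1 := by
  have h₁ : (t + 1) / k = t / k := by rw [Nat.succ_div, if_neg h, add_zero]
  have h₂ := Nat.div_add_mod t k
  have h₃ := Nat.div_add_mod (t + 1) k
  rw [h₁] at h₃
  exact ⟨h₁, by omega⟩

theorem succ_div_mod_of_dvd {k t : ℕ} (h : k ∣ t + 1) :
    (t + 1) / k = t / k + 1 ∧ t % k + 1 = k := by
  have h₁ : (t + 1) / k = t / k + 1 := by rw [Nat.succ_div, if_pos h]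
  have h₂ := Nat.div_add_mod t k
  have h₃ := Nat.div_mul_cancel h
  rw [h₁] at h₃
  exact ⟨h₁, by linarith⟩

/-- The start of a round acts as an incoming carry of weight 3^0. In both cases the weight 3^(t % k)
of the current digit may still be added within the budget of this round. -/
theorem ValueBound.carry {k t V : ℕ} {m : Bool} (h : ValueBound k t m V)
    (hm : m = true ∨ k ∣ t) : V + 3 ^ (t % k) ≤ t / k + 1 := by
  rcases hm with hm | hm
  · exact h.2.2 hm
  · rw [Nat.mod_eq_zero_of_dvd hm, pow_zero]
    exact Nat.succ_le_succ (h.2.1 hm).2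

theorem ValueBound.succ_false {k t V : ℕ} (h : V ≤ t / k + 1) :
    ValueBound k (t + 1) false V := by
  by_cases hd : k ∣ t + 1
  · have := succ_div_mod_of_dvd hd
    exact ⟨by omega, fun _ => ⟨rfl, by omega⟩, by simp⟩
  · have := succ_div_mod_of_not_dvd hd
    exact ⟨by omega, fun h => absurd h hd, by simp⟩

theorem ValueBound.succ_true {k t V : ℕ} (ht : t + 1 < 3 ^ k)
    (h : V + 3 ^ (t % k + 1) ≤ t / k + 1) : ValueBound k (t + 1) true V := by
  by_cases hd : k ∣ t + 1
  -- A carry out of the top digit would need 3^k ≤ t / k + 1, which `ht` excludes.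
  · have := (succ_div_mod_of_dvd hd).2
    rw [this] at h
    have := Nat.div_le_self t k
    omega
  · obtain ⟨h₁, h₂⟩ := succ_div_mod_of_not_dvd hd
    exact ⟨by rw [h₁]; exact (Nat.le_add_right _ _).trans h, fun h => absurd h hd,
      fun _ => by rw [h₁, h₂]; exact h⟩

/-- Digit d starts at position -d, so it is under the head when t ≡ d mod k, and each round visits
the digits from least to most significant. Definedness on all start states forces every block to be
a legal counter operation. -/
theorem exists_config [NeZero k]
    (hN : ∀ t : ℕ, (∀ c, (t : ZMod (N c)) = 0) ↔ k ∣ t) (w : List (Fin 2))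
    (hw : w.length + 1 < 3 ^ k)
    (hdef : ∀ q ∈ (startSet : Set (CounterState N k r)), (M).eval q w ≠ none) :
    ∃ (t : ℕ) (i : Fin 4) (m : Bool) (x : ZMod k → Fin 3), t ≤ w.length ∧
      (∀ c, (M).eval (ctl c 0 false 0) w = some (ctl c t m i)) ∧
      (∀ d, (M).eval (digit (-d) 0 0) w = some (digit ((t : ZMod k) - d) (x d) i)) ∧
      ValueBound k t m (value x) := by
  induction w using List.reverseRecOn with
  | nil =>
    exact ⟨0, 0, false, fun _ => 0, le_rfl, fun c => by simp [PFA.eval],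
      fun d => by simp [PFA.eval], by simp [ValueBound, value]⟩
  | append_singleton w a ih =>
    rw [List.length_append, List.length_singleton] at hw
    obtain ⟨t, i, m, x, ht, hc, hd, hV⟩ := ih (by omega) fun q hq h =>
      hdef q hq (by rw [PFA.eval_concat, h]; rfl)
    rw [List.length_append, List.length_singleton]
    have hc' (c : Bool) : (M).eval (ctl c 0 false 0) (w ++ [a]) =
        (M).step (ctl c t m i) a := by rw [PFA.eval_concat, hc c]; rfl
    have hd' (d : ZMod k) : (M).eval (digit (-d) 0 0) (w ++ [a]) =
        (M).step (digit ((t : ZMod k) - d) (x d) i) a := by rw [PFA.eval_concat, hd d]; rfl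
    have hcdef (c : Bool) : (M).step (ctl c t m i) a ≠ none := by
      rw [← hc']; exact hdef _ (.inl ⟨c, rfl⟩)
    have hddef (d : ZMod k) : (M).step (digit ((t : ZMod k) - d) (x d) i) a ≠ none := by
      rw [← hd']; exact hdef _ (.inr ⟨-d, rfl⟩)
    simp only [hc', hd']
    obtain rfl | rfl : a = 0 ∨ a = 1 := by clear * -; revert a; decide
    · exact ⟨t, i + 1, m, x, by omega, fun c => step_ctl_zero .., fun d => step_digit_zero ..,
        hV⟩
    · have hval : ((t : ZMod k)).val = t % k := ZMod.val_natCast ..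
      have hmove (v : Fin 3) (hv : (headStep (x t) i : Option (CounterState N k r)) =
          some (ring 1 v)) (d : ZMod k) : (M).step (digit ((t : ZMod k) - d) (x d) i) 1 =
          some (digit (((t + 1 : ℕ) : ZMod k) - d) (Function.update x t v d) 0) := by
        by_cases h : d = t
        · subst h
          rw [sub_self, step_digit_one_head, hv, Function.update_self, digit_zero_count]
          simp
        · rw [step_digit_one_of_ne (sub_ne_zero.mpr (Ne.symm h)), Function.update_of_ne h]
          push_cast
          rw [sub_add_eq_add_sub]
      have hhead : (headStep (x t) i : Option (CounterState N k r)) ≠ none := by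
        have := hddef t
        rwa [sub_self, step_digit_one_head] at this
      -- Both cycles hold the same carry flag, so without a carry both must be at 0, which happens
      -- only at the start of a round.
      have hcarry (h : ∀ c, m = true ∨ (t : ZMod (N c)) = 0) : m = true ∨ k ∣ t := by
        rw [← hN, or_iff_not_imp_left]
        exact fun hm c => (h c).resolve_left hm
      simp only [step_ctl_one] at hcdef ⊢
      match i with
      | 0 =>
        refine ⟨t + 1, 0, false, Function.update x t (x t), by omega, fun c => by simp [ctlStep],
          hmove _ rfl, ?_⟩
        rw [Function.update_eq_self]
        exact .succ_false hV.1
      | 1 =>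
        have hm (c : Bool) : m = true ∨ (t : ZMod (N c)) = 0 := by
          by_contra h
          exact hcdef c (by simp only [ctlStep, if_neg h])
        have hx : x t = 2 := by
          by_contra h
          exact hhead (by simp only [headStep, if_neg h])
        refine ⟨t + 1, 0, true, Function.update x t 0, by omega,
          fun c => by simp only [ctlStep, if_pos (hm c)]; push_cast; rfl,
          hmove _ (by simp [headStep, hx]), .succ_true (by omega) ?_⟩
        have h₁ := hV.carry (hcarry hm)
        have h₂ := value_reset hx
        rw [hval] at h₂
        rw [pow_succ]
        omega
      | 2 =>
        have hm (c : Bool) : m = true ∨ (t : ZMod (N c)) = 0 := by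
          by_contra h
          exact hcdef c (by simp only [ctlStep, if_neg h])
        have hx : x t ≠ 2 := by
          intro h
          exact hhead (by simp only [headStep, if_pos h])
        refine ⟨t + 1, 0, false, Function.update x t (x t + 1), by omega,
          fun c => by simp only [ctlStep, if_pos (hm c)]; push_cast; rfl,
          hmove _ (by simp [headStep, hx]), .succ_false ?_⟩
        rw [value_increment hx, hval]
        exact hV.carry (hcarry hm)
      | 3 =>
        have hm (c : Bool) : m = true ∧ (t : ZMod (N c)) = 0 := by
          by_contra h
          exact hcdef c (by simp only [ctlStep, if_neg h])
        -- Synchronization needs a carry at the start of a round, but the bound says that no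
        -- overflow has occurred yet.
        have := (hV.2.1 ((hN t).mp fun c => (hm c).2)).1
        rw [(hm true).1] at this
        cases this

theorem pow_le_length_of_carefullySynchronizes [NeZero k]
    (hN : ∀ t : ℕ, (∀ c, (t : ZMod (N c)) = 0) ↔ k ∣ t) {w : List (Fin 2)}
    (h : (M).CarefullySynchronizes startSet w) : 3 ^ k ≤ w.length + 1 := by
  rw [PFA.carefullySynchronizes_iff _ startSet_nonempty] at h
  obtain ⟨q, hq⟩ := h
  by_contra! hlt
  obtain ⟨t, i, m, x, -, hc, -, -⟩ := exists_config hN w hlt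
    fun s hs => by rw [hq s hs]; exact Option.some_ne_none q
  -- The two control states are still on different cycles, hence not merged.
  have h₁ := (hc true).symm.trans (hq _ (.inl ⟨true, rfl⟩))
  have h₂ := (hc false).symm.trans (hq _ (.inl ⟨false, rfl⟩))
  rw [← h₂] at h₁
  simp at h₁

end LowerBound

/-! ### Synchronizability: running the counter to overflow -/

section UpperBound

/-- A single word moves the counter from one configuration to another. -/
def Advance (N : Bool → ℕ) (k r : ℕ) (t : ℕ) (m : Bool) (x : ZMod k → Fin 3) (t' : ℕ) (m' : Bool)
    (x' : ZMod k → Fin 3) : Prop :=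
  ∃ w : List (Fin 2),
    (∀ c, (counterPFA N k r).eval (ctl c t m 0) w = some (ctl c t' m' 0)) ∧
    ∀ d, (counterPFA N k r).eval (digit ((t : ZMod k) - d) (x d) 0) w = some (digit ((t' : ZMod k) - d) (x' d) 0)

theorem Advance.refl (t : ℕ) (m : Bool) (x : ZMod k → Fin 3) : Advance N k r t m x t m x :=
  ⟨[], fun _ => rfl, fun _ => rfl⟩

theorem Advance.trans {t t' t'' : ℕ} {m m' m'' : Bool} {x x' x'' : ZMod k → Fin 3}
    (h : Advance N k r t m x t' m' x') (h' : Advance N k r t' m' x' t'' m'' x'') :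
    Advance N k r t m x t'' m'' x'' := by
  obtain ⟨u, hu, hu'⟩ := h
  obtain ⟨w, hw, hw'⟩ := h'
  exact ⟨u ++ w, fun c => by rw [PFA.eval_append_of_eq _ (hu c), hw],
    fun d => by rw [PFA.eval_append_of_eq _ (hu' d), hw']⟩

theorem advance_block {t : ℕ} {m m' : Bool} {x : ZMod k → Fin 3} (i : Fin 4) (v : Fin 3)
    (hc : ∀ c, (ctlStep c t m i : Option (CounterState N k r)) = some (ctl c ((t : ZMod (N c)) + 1) m' 0))
    (hv : (headStep (x t) i : Option (CounterState N k r)) = some (ring 1 v)) :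
    Advance N k r t m x (t + 1) m' (Function.update x t v) := by
  refine ⟨block i, fun c => ?_, fun d => ?_⟩
  · rw [eval_ctl_block, hc]
    push_cast
    rfl
  · by_cases h : d = t
    · subst h
      rw [sub_self, eval_digit_block_head, hv, Function.update_self, digit_zero_count]
      simp
    · rw [eval_digit_block_of_ne (sub_ne_zero.mpr (Ne.symm h)), Function.update_of_ne h]
      push_cast
      rw [sub_add_eq_add_sub]

/-- Adding one with carries: while the carry is pending, the s lowest digits were all 2 and have
been reset, a loss of 3^s - 1. Once a digit absorbs the carry, the rest are kept and the net gain is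
1. -/
theorem exists_advance_round [NeZero k] (hN : ∀ t : ℕ, (∀ c, (t : ZMod (N c)) = 0) ↔ k ∣ t)
    {t : ℕ} (ht : k ∣ t) (x : ZMod k → Fin 3) {s : ℕ} (hs : s ≤ k) :
    ∃ (m' : Bool) (x' : ZMod k → Fin 3), Advance N k r t false x (t + s) m' x' ∧
      ((m' = true ∨ s = 0) ∧ value x' + 3 ^ s = value x + 1 ∨
        m' = false ∧ value x' = value x + 1) := by
  induction s with
  | zero => exact ⟨false, x, .refl _ _ _, .inl ⟨.inr rfl, by simp⟩⟩
  | succ s ih =>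
    obtain ⟨m, y, hadv, h⟩ := ih (by omega)
    have hval : ((t + s : ℕ) : ZMod k).val = s := by
      rw [ZMod.val_natCast, Nat.add_mod, Nat.mod_eq_zero_of_dvd ht, zero_add, Nat.mod_mod,
        Nat.mod_eq_of_lt (by omega)]
    rcases h with ⟨hm, h⟩ | ⟨rfl, h⟩
    · have hc (c : Bool) : m = true ∨ ((t + s : ℕ) : ZMod (N c)) = 0 :=
        hm.imp_right fun hs => by subst hs; exact (hN t).mpr ht c
      by_cases hy : y (t + s : ℕ) = 2
      · refine ⟨true, _, hadv.trans (advance_block 1 0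
          (fun c => by simp only [ctlStep, if_pos (hc c)])
          (by simp only [headStep, if_pos hy])), .inl ⟨.inl rfl, ?_⟩⟩
        have := value_reset hy
        rw [hval] at this
        rw [pow_succ]
        omega
      · refine ⟨false, _, hadv.trans (advance_block 2 (y (t + s : ℕ) + 1)
          (fun c => by simp only [ctlStep, if_pos (hc c)])
          (by simp only [headStep, if_neg hy])), .inr ⟨rfl, ?_⟩⟩
        rw [value_increment hy, hval, h]
    · refine ⟨false, _, hadv.trans (advance_block 0 (y (t + s : ℕ)) (fun c => rfl) rfl),
        .inr ⟨rfl, ?_⟩⟩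
      rw [Function.update_eq_self, h]

/-- The sum is the largest value of the counter. Every round without overflow gains 1, so n bounds
the number of rounds still possible. -/
theorem exists_overflow [NeZero k] (hN : ∀ t : ℕ, (∀ c, (t : ZMod (N c)) = 0) ↔ k ∣ t)
    {t : ℕ} (ht : k ∣ t) (x : ZMod k → Fin 3) (n : ℕ)
    (hx : ∑ d : ZMod k, 2 * 3 ^ d.val < value x + n) :
    ∃ (t' : ℕ) (x' : ZMod k → Fin 3), k ∣ t' ∧ Advance N k r t false x t' true x' := by
  induction n generalizing t x with
  | zero =>
    exact absurd hx (Finset.sum_le_sum fun d _ =>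
      Nat.mul_le_mul_right _ (Nat.le_of_lt_succ (x d).is_lt)).not_gt
  | succ n ih =>
    obtain ⟨m, y, hadv, ⟨hm, h⟩ | ⟨rfl, h⟩⟩ :=
      exists_advance_round (r := r) hN ht x (le_refl k)
    · obtain rfl := hm.resolve_right (NeZero.ne k)
      exact ⟨t + k, y, ht.add (dvd_refl k), hadv⟩
    · obtain ⟨t', x', ht', hadv'⟩ := ih (ht.add (dvd_refl k)) y (by omega)
      exact ⟨t', x', ht', hadv.trans hadv'⟩

theorem exists_carefullySynchronizes [NeZero k]
    (hN : ∀ t : ℕ, (∀ c, (t : ZMod (N c)) = 0) ↔ k ∣ t) :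
    ∃ w, (M).CarefullySynchronizes startSet w := by
  obtain ⟨t, x, ht, u, hu, hu'⟩ := exists_overflow (r := r) hN (dvd_zero k) (fun _ => 0) _
    (Nat.lt_add_left _ (Nat.lt_succ_self _))
  refine ⟨u ++ syncWord k,
    (PFA.carefullySynchronizes_iff _ startSet_nonempty _).mpr ⟨sink 0, ?_⟩⟩
  rintro _ (⟨c, rfl⟩ | ⟨j, rfl⟩)
  · have := hu c
    rw [Nat.cast_zero] at this
    rw [PFA.eval_append_of_eq _ this, eval_ctl_syncWord ((hN t).mpr ht c)]
  · have := hu' (-j)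
    rw [Nat.cast_zero, zero_sub, neg_neg] at this
    rw [PFA.eval_append_of_eq _ this, eval_digit_syncWord']

end UpperBound

end CounterState

/-! ### Choice of parameters for each number of states -/

namespace PFA

/-- The automaton on `n` states in which every letter is the same cyclic permutation. -/
def cyclicPFA (n : ℕ) : PFA (Fin n) (Fin 2) where
  step q _ := some (finRotate n q)

theorem isTransitive_cyclicPFA (n : ℕ) : (cyclicPFA n).IsTransitive := by
  intro q q'
  have : NeZero n := ⟨fun h => by subst h; exact q.elim0⟩
  have h (t : ℕ) : (cyclicPFA n).Reaches (q + Fin.ofNat n t) (q + Fin.ofNat n (t + 1)) := by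
    refine .of_step 0 ?_
    have h1 : Fin.ofNat n (t + 1) = Fin.ofNat n t + 1 := Fin.ext (Nat.add_mod t 1 n)
    rw [h1, ← add_assoc]
    exact congrArg some (finRotate_apply _)
  have := Reaches.of_forall_succ h (q' - q).val
  simpa [Reaches] using this

/-- This serves the small n, where no growth is required: the empty word synchronizes a singleton.
-/
theorem exists_isTransitive_isShortestSyncLength {n : ℕ} (hn : 1 ≤ n) :
    ∃ (M : PFA (Fin n) (Fin 2)) (S : Set (Fin n)) (L : ℕ),
      M.IsTransitive ∧ M.IsShortestSyncLength S L := by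
  obtain ⟨L, hL⟩ := exists_isShortestSyncLength (M := cyclicPFA n) (S := {⟨0, hn⟩})
    ⟨[], Set.ncard_singleton _⟩
  exact ⟨_, _, L, isTransitive_cyclicPFA n, hL⟩

theorem natCast_zmod_eq_zero_iff_mul_succ_dvd (p t : ℕ) :
    (∀ c : Bool, (t : ZMod (bif c then p else p + 1)) = 0) ↔ p * (p + 1) ∣ t := by
  simp only [ZMod.natCast_eq_zero_iff, Bool.forall_bool, cond_true, cond_false]
  rw [and_comm]
  exact ⟨fun h => ((Nat.coprime_self_add_right.mpr (Nat.coprime_one_right p)).mul_dvd_of_dvd_of_dvd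
    h.1 h.2), fun h => ⟨(dvd_mul_right _ _).trans h, (dvd_mul_left _ _).trans h⟩⟩

theorem exists_three_pow_le_shortestSyncLength {p r n : ℕ} (hp : 0 < p) (hr : 0 < r)
    (hn : n = 8 * (p + (p + 1)) + 3 * (p * (p + 1)) + 13 + r) :
    ∃ (M : PFA (Fin n) (Fin 2)) (S : Set (Fin n)) (L : ℕ),
      M.IsTransitive ∧ M.IsShortestSyncLength S L ∧ 3 ^ (p * (p + 1)) ≤ L + 1 := by
  set N : Bool → ℕ := fun c => bif c then p else p + 1
  have : NeZero r := ⟨hr.ne'⟩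
  have : NeZero (p * (p + 1)) := ⟨by positivity⟩
  have (c : Bool) : NeZero (N c) := ⟨by cases c <;> simp [N]; omega⟩
  have hN : ∀ t : ℕ, (∀ c, (t : ZMod (N c)) = 0) ↔ p * (p + 1) ∣ t :=
    natCast_zmod_eq_zero_iff_mul_succ_dvd p
  obtain ⟨e⟩ := CounterState.nonempty_equiv_fin (N := N) (k := p * (p + 1)) (r := r) hn
  obtain ⟨w, hw⟩ := CounterState.exists_carefullySynchronizes (r := r) hN
  obtain ⟨L, hL⟩ := exists_isShortestSyncLength
    ⟨w, (carefullySynchronizes_rename _ e CounterState.startSet_nonempty w).mpr hw⟩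
  refine ⟨_, _, L, CounterState.isTransitive_counterPFA.rename e, hL, ?_⟩
  obtain ⟨u, rfl, hu⟩ := hL.1
  exact CounterState.pow_le_length_of_carefullySynchronizes hN
    ((carefullySynchronizes_rename _ e CounterState.startSet_nonempty u).mp hu)

theorem exists_pow_sqrt_le_shortestSyncLength {n : ℕ} (hn : 1 ≤ n) :
    ∃ (M : PFA (Fin n) (Fin 2)) (S : Set (Fin n)) (L : ℕ),
      M.IsTransitive ∧ M.IsShortestSyncLength S L ∧
        (5 ≤ (n / 3).sqrt → (3 : ℝ) ^ ((n : ℝ) / 3 - 9 * √n) ≤ L) := by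
  by_cases hs : 5 ≤ (n / 3).sqrt
  · obtain ⟨p, hp⟩ := Nat.exists_eq_add_of_le hs
    have h₁ := Nat.sqrt_le (n / 3)
    have h₃ := Nat.lt_succ_sqrt (n / 3)
    rw [hp] at h₁ h₃
    -- With s = 5 + p the integer square root of n / 3, the cycle lengths s - 4 and s - 3 use 3s² -
    -- 5s - 7 states before padding, which is less than 3s² ≤ n.
    have h₄ : 8 * ((p + 1) + (p + 1 + 1)) + 3 * ((p + 1) * (p + 1 + 1)) + 13 < n := by
      have : 3 * (n / 3) ≤ n := Nat.mul_div_le n 3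
      nlinarith
    obtain ⟨r, hr⟩ := Nat.exists_eq_add_of_lt h₄
    obtain ⟨M, S, L, hM, hL, hle⟩ := exists_three_pow_le_shortestSyncLength (p := p + 1)
      (r := r + 1) (n := n) (Nat.succ_pos p) (Nat.succ_pos r) (by omega)
    refine ⟨M, S, L, hM, hL, fun _ => ?_⟩
    have h₅ : ((5 + p : ℕ) : ℝ) ≤ √n := by
      apply Real.le_sqrt_of_sq_le
      have : (5 + p) ^ 2 ≤ n := by
        have := Nat.div_le_self n 3
        nlinarith
      exact_mod_cast this
    have h₆ : (n : ℝ) ≤ 3 * ((5 + p : ℕ) + 1 : ℝ) ^ 2 := by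
      have : n ≤ 3 * (5 + p + 1) ^ 2 := by
        have : n < 3 * (n / 3) + 3 := by omega
        simp only [Nat.succ_eq_add_one] at h₃
        nlinarith
      exact_mod_cast this
    -- The constant 9: n/3 ≤ (s + 1)² and k - 1 = s² - 7s + 11 differ by at most 9s - 10, and s ≤
    -- √n.
    have h₇ : (n : ℝ) / 3 - 9 * √n ≤ (((p + 1) * (p + 1 + 1) - 1 : ℕ) : ℝ) := by
      rw [Nat.cast_sub (by nlinarith)]
      push_cast at h₅ h₆ ⊢
      nlinarith
    calc (3 : ℝ) ^ ((n : ℝ) / 3 - 9 * √n)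
        ≤ 3 ^ (((p + 1) * (p + 1 + 1) - 1 : ℕ) : ℝ) :=
          Real.rpow_le_rpow_of_exponent_le (by norm_num) h₇
      _ = ((3 ^ ((p + 1) * (p + 1 + 1) - 1) : ℕ) : ℝ) := by rw [Real.rpow_natCast]; norm_cast
      _ ≤ L := by
          have h₈ : (p + 1) * (p + 1 + 1) = (p + 1) * (p + 1 + 1) - 1 + 1 :=
            (Nat.sub_add_cancel (by nlinarith)).symm
          rw [h₈, pow_succ] at hle
          have := Nat.one_le_pow ((p + 1) * (p + 1 + 1) - 1) 3 (by norm_num)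
          exact_mod_cast (by omega : 3 ^ ((p + 1) * (p + 1 + 1) - 1) ≤ L)
  · obtain ⟨M, S, L, hM, hL⟩ := exists_isTransitive_isShortestSyncLength hn
    exact ⟨M, S, L, hM, hL, fun h => absurd h hs⟩

end PFA

/-! ### Asymptotics -/

theorem eventually_rpow_le_three_rpow_sub_sqrt {b : ℝ} (hb : 0 < b) (hb' : b < 3) (C : ℝ) :
    ∀ᶠ n : ℕ in atTop, b ^ ((n : ℝ) / 3) ≤ (3 : ℝ) ^ ((n : ℝ) / 3 - C * √n) := by
  have hδ : 0 < Real.log 3 - Real.log b := sub_pos.mpr (Real.log_lt_log hb hb')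
  have htop : Tendsto (fun n : ℕ => √(n : ℝ)) atTop atTop :=
    Real.tendsto_sqrt_atTop.comp tendsto_natCast_atTop_atTop
  filter_upwards [htop.eventually_ge_atTop (3 * C * Real.log 3 / (Real.log 3 - Real.log b))]
    with n hn
  rw [Real.rpow_def_of_pos hb, Real.rpow_def_of_pos (by norm_num), Real.exp_le_exp]
  rw [div_le_iff₀ hδ] at hn
  have hs := mul_le_mul_of_nonneg_right hn (Real.sqrt_nonneg n)
  have hsq := Real.mul_self_sqrt (Nat.cast_nonneg (α := ℝ) n)
  have : √(n : ℝ) * (Real.log 3 - Real.log b) * √n = n * (Real.log 3 - Real.log b) := by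
    rw [mul_right_comm, hsq]
  rw [this] at hs
  linarith

theorem mainTheorem5 :
    ∃ (M : ∀ n : ℕ, PFA (Fin n) (Fin 2)) (S : ∀ n : ℕ, Set (Fin n)) (L : ℕ → ℕ),
      (∀ n : ℕ, 1 ≤ n → (M n).IsTransitive ∧ (M n).IsShortestSyncLength (S n) (L n)) ∧
      (∀ ε : ℝ, 0 < ε → ε < 3 →
        ∃ c : ℝ, 0 < c ∧ ∀ᶠ n : ℕ in atTop, c * (3 - ε) ^ ((n : ℝ) / 3) ≤ (L n : ℝ)) ∧
      (∃ c : ℝ, 0 < c ∧ ∀ᶠ n : ℕ in atTop, c * (1.4422 : ℝ) ^ n ≤ (L n : ℝ)) := by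
  have hex (n : ℕ) : ∃ (M : PFA (Fin n) (Fin 2)) (S : Set (Fin n)) (L : ℕ), 1 ≤ n →
      M.IsTransitive ∧ M.IsShortestSyncLength S L ∧
        (5 ≤ (n / 3).sqrt → (3 : ℝ) ^ ((n : ℝ) / 3 - 9 * √n) ≤ L) := by
    rcases Nat.eq_zero_or_pos n with rfl | hn
    · exact ⟨PFA.cyclicPFA 0, ∅, 0, fun h => absurd h (by norm_num)⟩
    · obtain ⟨M, S, L, h⟩ := PFA.exists_pow_sqrt_le_shortestSyncLength hn
      exact ⟨M, S, L, fun _ => h⟩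
  choose M S L h using hex
  have hlower (b : ℝ) (hb : 0 < b) (hb' : b < 3) :
      ∀ᶠ n : ℕ in atTop, b ^ ((n : ℝ) / 3) ≤ (L n : ℝ) := by
    -- The threshold 75 = 3 · 5² gives an integer square root of n / 3 of at least 5.
    filter_upwards [eventually_rpow_le_three_rpow_sub_sqrt hb hb' 9, eventually_ge_atTop 75]
      with n hn hn'
    exact hn.trans ((h n (by omega)).2.2 (Nat.le_sqrt.mpr (by omega)))
  refine ⟨M, S, L, fun n hn => ⟨(h n hn).1, (h n hn).2.1⟩, fun ε hε hε' => ⟨1, one_pos, ?_⟩,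
    1, one_pos, ?_⟩
  · simpa only [one_mul] using hlower (3 - ε) (by linarith) (by linarith)
  -- The base works because 1.4422³ < 3.
  · filter_upwards [hlower (1.4422 ^ 3) (by norm_num) (by norm_num)] with n hn
    rw [one_mul]
    refine le_trans (le_of_eq ?_) hn
    rw [← Real.rpow_natCast, ← Real.rpow_natCast, ← Real.rpow_mul (by norm_num)]
    congr 1
    push_cast
    ring
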